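/- **Theorem (law of large numbers for the elephant random walk with random step sizes, diffusive regime).** Let $d\ge 1$ and $0\le p<\frac{2d+1}{4d}$. Let $e_1,\dots,e_d$ be the standard basis of $\mathbb{R}^d$, let $I_d$ be the identity matrix, and let $J_d$ be the $d\times d$ cyclic shift matrix, whose entries are $1$ at the positions $(i,i+1)$, $1\le i<d$, and $(d,1)$, and $0$ elsewhere. On a probability space, let $X_1$ be uniformly distributed on $\{\pm e_1,\dots,\pm e_d\}$ and, for $n\ge 1$, let $$X_{n+1}=A_{n+1}X_{\beta(n)},$$ where $\beta(n)$ is uniform on $\{1,\dots,n\}$ and $A_{n+1}$ is a random matrix which equals $I_d$ with probability $p$ and equals each of $-I_d,\pm J_d,\pm J_d^2,\dots,\pm J_d^{d-1}$ with probability $\frac{1-p}{2d-1}$. Let the step size $Y_1$ be a positive random variable with finite mean and variance, and let $(Y_n)_{n\ge 2}$ be nonnegative i.i.d. random variables with finite mean and variance. Suppose that for every $n\ge 1$ the random variables $A_{n+1}$, $\beta(n)$, $Y_{n+1}$ are mutually independent, and that the triple $(A_{n+1},\beta(n),Y_{n+1})$ is independent of the history $(X_1,\dots,X_n,Y_1,\dots,Y_n)$.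 Let $$S_n=\sum_{k=1}^n T_k,\qquad T_k=X_kY_k .$$ Then, for every $\alpha>\frac12$, $$\lim_{n\to\infty}\frac{S_n}{n^{\alpha}}=0\quad\text{almost surely.}$$ -/

import Mathlib

open MeasureTheory ProbabilityTheory Filter Topology Matrix

noncomputable section

namespace MERW

/-- The `d × d` cyclic shift matrix `J_d`: ones at the entries `(i, i + 1)` and at `(d, 1)`. -/
def shiftMatrix (d : ℕ) : Matrix (Fin d) (Fin d) ℝ :=
  Matrix.of fun i j => if (j : ℕ) = ((i : ℕ) + 1) % d then 1 else 0

instance (d : ℕ) : MeasurableSpace (Matrix (Fin d) (Fin d) ℝ) :=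
  inferInstanceAs (MeasurableSpace (Fin d → Fin d → ℝ))

/-- The law of the random matrices `A_{n+1}`: mass `p` at `I_d`, and mass `(1 - p) / (2 d - 1)`
at each of `-I_d, ± J_d, …, ± J_d ^ (d - 1)`. -/
def matrixLaw (d : ℕ) (p : ℝ) : Measure (Matrix (Fin d) (Fin d) ℝ) :=
  ENNReal.ofReal p • Measure.dirac 1 +
    ENNReal.ofReal ((1 - p) / (2 * d - 1)) •
      (Measure.dirac (-1) +
        ∑ i ∈ Finset.Ico 1 d,
          (Measure.dirac (shiftMatrix d ^ i) + Measure.dirac (-(shiftMatrix d ^ i))))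

/-- The uniform distribution on the `2 d` unit vectors `± e_1, …, ± e_d`. -/
def firstLaw (d : ℕ) : Measure (Fin d → ℝ) :=
  ENNReal.ofReal (1 / (2 * d)) •
    ∑ i : Fin d, (Measure.dirac (Pi.single i (1 : ℝ)) + Measure.dirac (-(Pi.single i (1 : ℝ))))

/-- The unit steps of the elephant random walk, for one realisation of its inputs:
`X_1 = x₁` and `X_{n+1} = A_{n+1} X_{β(n)}` for `n ≥ 1`. The value at `0`, and the value when
`β(n)` lies outside `{0, …, n}` (which has probability zero below), are fillers. -/
def dir {d : ℕ} (x₁ : Fin d → ℝ) (A : ℕ → Matrix (Fin d) (Fin d) ℝ) (β : ℕ → ℕ) :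
    ℕ → (Fin d → ℝ)
  | 0 => 0
  | 1 => x₁
  | n + 2 => if _h : β (n + 1) < n + 2 then A (n + 2) *ᵥ dir x₁ A β (β (n + 1)) else 0

variable {Ω : Type*} {d : ℕ}

/-- The random unit step `X_n`, `n ≥ 1`. -/
def X (X₁ : Ω → Fin d → ℝ) (A : ℕ → Ω → Matrix (Fin d) (Fin d) ℝ) (β : ℕ → Ω → ℕ)
    (n : ℕ) (ω : Ω) : Fin d → ℝ :=
  dir (X₁ ω) (fun k => A k ω) (fun k => β k ω) n

/-- The step `T_n = X_n Y_n`, `n ≥ 1`; that is, `T_1 = X_1 Y_1` and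
`T_{n+1} = A_{n+1} X_{β(n)} Y_{n+1}`. -/
def T (X₁ : Ω → Fin d → ℝ) (A : ℕ → Ω → Matrix (Fin d) (Fin d) ℝ) (β : ℕ → Ω → ℕ)
    (Y : ℕ → Ω → ℝ) (n : ℕ) (ω : Ω) : Fin d → ℝ :=
  Y n ω • X X₁ A β n ω

/-- The position `S_n = T_1 + ⋯ + T_n`. -/
def S (X₁ : Ω → Fin d → ℝ) (A : ℕ → Ω → Matrix (Fin d) (Fin d) ℝ) (β : ℕ → Ω → ℕ)
    (Y : ℕ → Ω → ℝ) (n : ℕ) (ω : Ω) : Fin d → ℝ :=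
  ∑ k ∈ Finset.Icc 1 n, T X₁ A β Y k ω

/-- The random inputs `X_1`, `(A_n)_{n ≥ 2}`, `(β(n))_{n ≥ 1}`, `(Y_n)_{n ≥ 1}` drive a
multidimensional elephant random walk with random step sizes and memory parameter `p`. -/
structure IsInput [MeasurableSpace Ω] (P : Measure Ω) (p : ℝ) (X₁ : Ω → Fin d → ℝ)
    (A : ℕ → Ω → Matrix (Fin d) (Fin d) ℝ) (β : ℕ → Ω → ℕ) (Y : ℕ → Ω → ℝ) : Prop where
  measurable_first : Measurable X₁
  measurable_matrix : ∀ n, 2 ≤ n → Measurable (A n)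
  measurable_memory : ∀ n, 1 ≤ n → Measurable (β n)
  measurable_size : ∀ n, 1 ≤ n → Measurable (Y n)
  /-- `X_1` is uniform on `{± e_1, …, ± e_d}`. -/
  law_first : P.map X₁ = firstLaw d
  law_matrix : ∀ n, 2 ≤ n → P.map (A n) = matrixLaw d p
  /-- `β(n)` is uniform on `{1, …, n}`. -/
  law_memory : ∀ n, 1 ≤ n → P.map (β n) = uniformOn (Set.Icc 1 n)
  /-- `Y_1` is positive, with finite mean and variance. -/
  first_size_pos : ∀ᵐ ω ∂P, 0 < Y 1 ω
  first_size_memLp : MemLp (Y 1) 2 P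
  /-- `(Y_n)_{n ≥ 2}` are nonnegative and iid, with finite mean and variance. -/
  size_nonneg : ∀ n, 2 ≤ n → ∀ᵐ ω ∂P, 0 ≤ Y n ω
  size_memLp : ∀ n, 2 ≤ n → MemLp (Y n) 2 P
  size_identDistrib : ∀ n, 2 ≤ n → IdentDistrib (Y n) (Y 2) P P
  size_indep : iIndepFun (fun n => Y (n + 2)) P
  /-- `A_{n+1}`, `β(n)` and `Y_{n+1}` are (mutually) independent: the first is independent of the
  other two, and these are independent of each other. -/
  indep_matrix : ∀ n, 1 ≤ n → IndepFun (A (n + 1)) (fun ω => (β n ω, Y (n + 1) ω)) P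
  indep_memory_size : ∀ n, 1 ≤ n → IndepFun (β n) (Y (n + 1)) P
  /-- `(A_{n+1}, β(n), Y_{n+1})` is independent of the history `X_1, Y_1, …, X_n, Y_n`. -/
  indep_history : ∀ n, 1 ≤ n →
    IndepFun (fun ω => (A (n + 1) ω, β n ω, Y (n + 1) ω))
      (fun ω (k : Finset.Icc 1 n) => (X X₁ A β k ω, Y k ω)) P

end MERW

end

/-! In the matrix law each `J_d ^ k` with `1 ≤ k < d` cancels against its negative, so `E[A] = a I`
with `a = meanCoeff d p`. Writing `W_n = X_1 + ⋯ + X_n`, `F_n` for the history and `μ = E[Y_2]`,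
this gives `E[T_{n+1} | F_n] = (a μ / n) W_n`. Hence each step is a martingale difference plus the
drift `(a μ / n) W_n`.

The differences are bounded in `L²`, so their series with weights `n ^ (-α)` converges almost surely
when `2 α > 1` (`ae_tendsto_sum_centredStep`). For the drift, `E[W_{n+1}²] ≤ (1 + 2 a / n) E[W_n²] +
1`, and `a < 1/2` is exactly the diffusive condition; thus `E[W_n²] = O(n)`
(`exists_integral_sq_dirSum_le`). Then `n ^ (-α - 1) |W_n|` has expectation `O(n ^ (-α - 1/2))` and
is almost surely summable (`ae_summable_dirSum`). So `∑ n ^ (-α) T_{n+1}` converges coordinatewise,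
and Kronecker's lemma concludes. -/

/-! ### Kronecker's lemma and almost sure summability -/

/-- **Kronecker's lemma**. -/
theorem tendsto_inv_mul_sum_of_tendsto_sum {b x : ℕ → ℝ} {s : ℝ} (hb : Monotone b)
    (hb' : Tendsto b atTop atTop)
    (hx : Tendsto (fun n => ∑ k ∈ Finset.range n, x k) atTop (𝓝 s)) :
    Tendsto (fun n => (b n)⁻¹ * ∑ k ∈ Finset.range n, b k * x k) atTop (𝓝 0) := by
  set σ : ℕ → ℝ := fun n => ∑ k ∈ Finset.range n, x k with hσ
  -- Abel summation; subtracting the limit `s` leaves factors `σ - s` that tend to 0.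
  have abel : ∀ n, ∑ k ∈ Finset.range n, b k * x k =
      b n * (σ n - s) + b 0 * s - ∑ k ∈ Finset.range n, (b (k + 1) - b k) * (σ (k + 1) - s) := by
    intro n
    induction n with
    | zero => simp [hσ]
    | succ n ih =>
      have : σ (n + 1) = σ n + x n := by simp [hσ, Finset.sum_range_succ]
      rw [Finset.sum_range_succ, ih, Finset.sum_range_succ, this]
      ring
  have hσ0 : Tendsto (fun n => σ n - s) atTop (𝓝 0) := by
    simpa using hx.sub_const s
  have hinv : Tendsto (fun n => (b n)⁻¹) atTop (𝓝 0) := tendsto_inv_atTop_zero.comp hb'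
  have hsum : Tendsto (fun n => (b n)⁻¹ *
      ∑ k ∈ Finset.range n, (b (k + 1) - b k) * (σ (k + 1) - s)) atTop (𝓝 0) := by
    -- The increments of `b` are nonnegative with divergent sum, so little-o passes to partial sums.
    have h1 : (fun k => (b (k + 1) - b k) * (σ (k + 1) - s)) =o[atTop]
        fun k => b (k + 1) - b k := by
      have h := (Asymptotics.isBigO_refl (fun k => b (k + 1) - b k) atTop).mul_isLittleO
        ((Asymptotics.isLittleO_one_iff ℝ).2 (hσ0.comp (tendsto_add_atTop_nat 1)))
      simpa using h
    have htele : ∀ n, ∑ k ∈ Finset.range n, (b (k + 1) - b k) = b n - b 0 :=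
      fun n => Finset.sum_range_sub b n
    have h2 := h1.sum_range (fun k => sub_nonneg.2 (hb (Nat.le_succ k))) (by
      simp_rw [htele]
      exact tendsto_atTop_add_const_right _ _ hb')
    simp_rw [htele] at h2
    have h3 : (fun n => b n - b 0) =O[atTop] b :=
      (Asymptotics.isBigO_refl b atTop).sub
        (Asymptotics.isLittleO_const_left.2
          (Or.inr (tendsto_norm_atTop_atTop.comp hb'))).isBigO
    have h4 := (h2.trans_isBigO h3).tendsto_div_nhds_zero
    simpa [div_eq_inv_mul] using h4
  have hlim := ((hσ0.add (hinv.mul_const (b 0 * s))).sub hsum)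
  simp only [zero_mul, add_zero, sub_zero] at hlim
  refine hlim.congr' ?_
  filter_upwards [hb'.eventually_gt_atTop 0] with n hn
  rw [abel]
  field_simp

/-- Nonnegative functions with summable integrals are almost everywhere summable. -/
theorem ae_summable_of_summable_integral {Ω : Type*} [MeasurableSpace Ω] {μ : Measure Ω}
    {f : ℕ → Ω → ℝ} (hf : ∀ n, Integrable (f n) μ) (hf0 : ∀ n ω, 0 ≤ f n ω)
    (hs : Summable fun n => ∫ ω, f n ω ∂μ) : ∀ᵐ ω ∂μ, Summable fun n => f n ω := by
  have hfin : ∫⁻ ω, ∑' n, ENNReal.ofReal (f n ω) ∂μ ≠ ⊤ := by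
    rw [lintegral_tsum fun n => (hf n).aemeasurable.ennreal_ofReal]
    simp_rw [← ofReal_integral_eq_lintegral_ofReal (hf _) (ae_of_all _ (hf0 _))]
    exact hs.tsum_ofReal_ne_top
  filter_upwards [ae_lt_top' (AEMeasurable.tsum
    fun n => (hf n).aemeasurable.ennreal_ofReal) hfin] with ω hω
  have := ENNReal.summable_toReal hω.ne
  simpa [ENNReal.toReal_ofReal, hf0] using this

/-! ### The law of the random matrices -/

namespace MERW

/-- The mean of the random matrices is `meanCoeff d p` times the identity. -/
noncomputable def meanCoeff (d : ℕ) (p : ℝ) : ℝ := (2 * d * p - 1) / (2 * d - 1)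

theorem meanCoeff_lt_half {d : ℕ} (hd : 1 ≤ d) {p : ℝ} (hp : p < (2 * d + 1) / (4 * d)) :
    meanCoeff d p < 1 / 2 := by
  have hd' : (1 : ℝ) ≤ d := by exact_mod_cast hd
  rw [lt_div_iff₀ (by linarith)] at hp
  rw [meanCoeff, div_lt_iff₀ (by linarith)]
  linarith

theorem le_one_of_lt_critical {d : ℕ} (hd : 1 ≤ d) {p : ℝ} (hp : p < (2 * d + 1) / (4 * d)) :
    p ≤ 1 := by
  have hd' : (1 : ℝ) ≤ d := by exact_mod_cast hd
  refine hp.le.trans ?_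
  rw [div_le_one (by linarith)]
  linarith

instance (d : ℕ) : MeasurableSingletonClass (Matrix (Fin d) (Fin d) ℝ) :=
  inferInstanceAs (MeasurableSingletonClass (Fin d → Fin d → ℝ))

theorem measurable_entry {d : ℕ} (i j : Fin d) :
    Measurable fun M : Matrix (Fin d) (Fin d) ℝ => M i j :=
  (measurable_pi_apply j).comp (measurable_pi_apply (X := fun _ : Fin d => Fin d → ℝ) i)

/-- The shift permutes coordinates, and the norm on `Fin d → ℝ` is the sup norm. -/
theorem norm_shiftMatrix_mulVec_le {d : ℕ} (v : Fin d → ℝ) : ‖shiftMatrix d *ᵥ v‖ ≤ ‖v‖ := by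
  rw [pi_norm_le_iff_of_nonneg (norm_nonneg v)]
  intro i
  have hd : 0 < d := i.pos
  have : (shiftMatrix d *ᵥ v) i = v ⟨((i : ℕ) + 1) % d, Nat.mod_lt _ hd⟩ := by
    rw [mulVec, dotProduct, Finset.sum_eq_single ⟨((i : ℕ) + 1) % d, Nat.mod_lt _ hd⟩]
    · simp [shiftMatrix]
    · intro j _ hj
      have : (j : ℕ) ≠ ((i : ℕ) + 1) % d := fun h => hj (Fin.ext h)
      simp [shiftMatrix, this]
    · simp
  rw [this]
  exact norm_le_pi_norm v _

theorem norm_shiftMatrix_pow_mulVec_le {d : ℕ} (k : ℕ) (v : Fin d → ℝ) :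
    ‖(shiftMatrix d ^ k) *ᵥ v‖ ≤ ‖v‖ := by
  induction k generalizing v with
  | zero => simp
  | succ k ih =>
    rw [pow_succ, ← mulVec_mulVec]
    exact (ih _).trans (norm_shiftMatrix_mulVec_le v)

theorem ae_matrixLaw_norm_mulVec_le (d : ℕ) (p : ℝ) :
    ∀ᵐ M ∂matrixLaw d p, ∀ v : Fin d → ℝ, ‖M *ᵥ v‖ ≤ ‖v‖ := by
  unfold matrixLaw
  rw [ae_add_measure_iff]
  refine ⟨Measure.ae_smul_measure ?_ _, Measure.ae_smul_measure ?_ _⟩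
  · simp [ae_dirac_eq]
  · rw [ae_add_measure_iff]
    refine ⟨by simp [ae_dirac_eq, neg_mulVec], ?_⟩
    rw [ae_finsetSum_measure_iff]
    intro i _
    rw [ae_add_measure_iff]
    simp [ae_dirac_eq, neg_mulVec, norm_shiftMatrix_pow_mulVec_le]

theorem ae_firstLaw_norm_le (d : ℕ) : ∀ᵐ v ∂firstLaw d, ‖v‖ ≤ 1 := by
  unfold firstLaw
  refine Measure.ae_smul_measure ?_ _
  rw [ae_finsetSum_measure_iff]
  intro i _
  rw [ae_add_measure_iff]
  simp [ae_dirac_eq, Pi.norm_single]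

/-- The pairs `± J_d ^ k` have equal mass and cancel; what remains is `p - (1 - p) / (2 d - 1)`
times the identity. -/
theorem integral_entry_matrixLaw {d : ℕ} (hd : 1 ≤ d) {p : ℝ} (hp₀ : 0 ≤ p) (hp₁ : p ≤ 1)
    (i j : Fin d) :
    ∫ M, M i j ∂matrixLaw d p = meanCoeff d p * (1 : Matrix (Fin d) (Fin d) ℝ) i j := by
  have hd' : (1 : ℝ) ≤ d := by exact_mod_cast hd
  have hint : ∀ N : Matrix (Fin d) (Fin d) ℝ,
      Integrable (fun M : Matrix (Fin d) (Fin d) ℝ => M i j) (Measure.dirac N) :=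
    fun N => integrable_dirac' (measurable_entry i j).stronglyMeasurable (by simp)
  have hq : 0 ≤ (1 - p) / (2 * d - 1) := div_nonneg (by linarith) (by linarith)
  have hsum : ∀ k ∈ Finset.Ico 1 d, Integrable (fun M : Matrix (Fin d) (Fin d) ℝ => M i j)
      (Measure.dirac (shiftMatrix d ^ k) + Measure.dirac (-(shiftMatrix d ^ k))) :=
    fun k _ => (hint _).add_measure (hint _)
  have hsum' := integrable_finsetSum_measure.2 hsum
  have hne : (2 * d - 1 : ℝ) ≠ 0 := by linarith
  unfold matrixLaw
  rw [integral_add_measure ((hint _).smul_measure (by simp))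
      (((hint _).add_measure hsum').smul_measure (by simp)),
    integral_smul_measure, integral_smul_measure, integral_add_measure (hint _) hsum',
    integral_finsetSum_measure hsum]
  simp_rw [integral_add_measure (hint _) (hint _),
    integral_dirac' _ _ (measurable_entry i j).stronglyMeasurable]
  simp only [Matrix.neg_apply, add_neg_cancel, Finset.sum_const_zero, add_zero,
    ENNReal.toReal_ofReal hp₀, ENNReal.toReal_ofReal hq, smul_eq_mul, meanCoeff]
  field_simp
  ring

end MERW

/-! ### The recursion for the unit steps and their history -/

namespace MERW

variable {Ω : Type*} {d : ℕ} {X₁ : Ω → Fin d → ℝ}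
  {A : ℕ → Ω → Matrix (Fin d) (Fin d) ℝ} {β : ℕ → Ω → ℕ} {Y : ℕ → Ω → ℝ}

theorem X_zero (ω : Ω) : X X₁ A β 0 ω = 0 := by
  simp [X, dir]

theorem X_one (ω : Ω) : X X₁ A β 1 ω = X₁ ω := by
  simp [X, dir]

theorem X_add_two (n : ℕ) (ω : Ω) : X X₁ A β (n + 2) ω =
    if β (n + 1) ω < n + 2 then A (n + 2) ω *ᵥ X X₁ A β (β (n + 1) ω) ω else 0 := by
  simp only [X, dir]
  split_ifs <;> rfl

/-- Splitting over the value of `β n` turns the random index into products of a matrix entry, an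
indicator and a past coordinate, to which independence applies. -/
theorem X_succ_apply {n : ℕ} (hn : 1 ≤ n) (i : Fin d) (ω : Ω) :
    X X₁ A β (n + 1) ω i = ∑ k ∈ Finset.Icc 1 n, ∑ j,
      A (n + 1) ω i j * (if β n ω = k then 1 else 0) * X X₁ A β k ω j := by
  obtain ⟨m, rfl⟩ := Nat.exists_eq_add_of_le' hn
  rw [X_add_two]
  by_cases hβ : β (m + 1) ω ∈ Finset.Icc 1 (m + 1)
  · rw [Finset.sum_eq_single (β (m + 1) ω)]
    · have : β (m + 1) ω < m + 2 := by have := (Finset.mem_Icc.1 hβ).2; omega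
      simp [this, mulVec, dotProduct]
    · intro k _ hk
      simp [Ne.symm hk]
    · exact fun h => absurd hβ h
  · have h0 : ∀ k ∈ Finset.Icc 1 (m + 1), β (m + 1) ω ≠ k := fun k hk h => hβ (h ▸ hk)
    rw [Finset.sum_eq_zero fun k hk => by simp [h0 k hk]]
    -- Outside `{1, …, n}` the fillers are 0, so the identity holds for every `ω`: `β = 0` selects
    -- `X 0 = 0`, and larger values fall in the `else` branch.
    split_ifs with hlt
    · have : β (m + 1) ω = 0 := by
        by_contra h
        exact hβ (Finset.mem_Icc.2 ⟨by omega, by omega⟩)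
      simp [this, X_zero]
    · rfl

variable [MeasurableSpace Ω] {P : Measure Ω} {p : ℝ}

namespace IsInput

theorem measurable_X (h : IsInput P p X₁ A β Y) (n : ℕ) : Measurable (X X₁ A β n) := by
  induction n using Nat.strong_induction_on with
  | _ n ih =>
    match n with
    | 0 => simp [funext X_zero]
    | 1 => simpa [funext X_one] using h.measurable_first
    | n + 2 =>
      rw [measurable_pi_iff]
      intro i
      simp_rw [X_succ_apply (Nat.le_add_left 1 n)]
      refine Finset.measurable_fun_sum _ fun k hk => Finset.measurable_fun_sum _ fun j _ => ?_
      have hk' := Finset.mem_Icc.1 hk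
      refine (((measurable_entry i j).comp (h.measurable_matrix _ (by omega))).mul ?_).mul
        ((measurable_pi_apply j).comp (ih k (by omega)))
      exact Measurable.ite (h.measurable_memory _ (by omega) (measurableSet_singleton k))
        measurable_const measurable_const

theorem ae_norm_X_le (h : IsInput P p X₁ A β Y) : ∀ᵐ ω ∂P, ∀ n, ‖X X₁ A β n ω‖ ≤ 1 := by
  have h1 : ∀ᵐ ω ∂P, ‖X₁ ω‖ ≤ 1 :=
    ae_of_ae_map h.measurable_first.aemeasurable (h.law_first ▸ ae_firstLaw_norm_le d)
  have h2 : ∀ᵐ ω ∂P, ∀ n, ∀ v, ‖A (n + 2) ω *ᵥ v‖ ≤ ‖v‖ := ae_all_iff.2 fun n =>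
    ae_of_ae_map (h.measurable_matrix _ (by omega)).aemeasurable
      (h.law_matrix (n + 2) (by omega) ▸ ae_matrixLaw_norm_mulVec_le d p)
  filter_upwards [h1, h2] with ω h1 h2 n
  induction n using Nat.strong_induction_on with
  | _ n ih =>
    match n with
    | 0 => simp [X_zero]
    | 1 => simpa [X_one] using h1
    | n + 2 =>
      rw [X_add_two]
      split_ifs with hlt
      · exact (h2 n _).trans (ih _ hlt)
      · simp

/-- The history `X_1, Y_1, …, X_n, Y_n`. -/
def history (X₁ : Ω → Fin d → ℝ) (A : ℕ → Ω → Matrix (Fin d) (Fin d) ℝ) (β : ℕ → Ω → ℕ)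
    (Y : ℕ → Ω → ℝ) (n : ℕ) (ω : Ω) (k : Finset.Icc 1 n) : (Fin d → ℝ) × ℝ :=
  (X X₁ A β k ω, Y k ω)

theorem measurable_history (h : IsInput P p X₁ A β Y) (n : ℕ) :
    Measurable (history X₁ A β Y n) := by
  rw [measurable_pi_iff]
  exact fun k => (h.measurable_X k).prodMk (h.measurable_size k (Finset.mem_Icc.1 k.2).1)

/-- The filtration generated by the history of the walk. -/
def filtration (h : IsInput P p X₁ A β Y) : Filtration ℕ ‹MeasurableSpace Ω› where
  seq n := MeasurableSpace.comap (history X₁ A β Y n) inferInstance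
  mono' m n hmn := by
    have : history X₁ A β Y m = (fun (f : Finset.Icc 1 n → (Fin d → ℝ) × ℝ) (k : Finset.Icc 1 m) =>
        f ⟨k, Finset.Icc_subset_Icc_right hmn k.2⟩) ∘ history X₁ A β Y n := rfl
    simp only [this, ← MeasurableSpace.comap_comp]
    refine MeasurableSpace.comap_mono (Measurable.comap_le ?_)
    exact measurable_pi_iff.2 fun k => measurable_pi_apply _
  le' n := (h.measurable_history n).comap_le

theorem measurable_filtration_pair (h : IsInput P p X₁ A β Y) {k n : ℕ} (hk : 1 ≤ k)
    (hkn : k ≤ n) : Measurable[h.filtration n] fun ω => (X X₁ A β k ω, Y k ω) := by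
  exact (measurable_pi_apply (⟨k, Finset.mem_Icc.2 ⟨hk, hkn⟩⟩ : Finset.Icc 1 n)).comp
    (comap_measurable (history X₁ A β Y n))

theorem measurable_filtration_X (h : IsInput P p X₁ A β Y) {k n : ℕ} (hk : 1 ≤ k)
    (hkn : k ≤ n) (i : Fin d) : Measurable[h.filtration n] fun ω => X X₁ A β k ω i :=
  (measurable_pi_apply i).comp (measurable_fst.comp (h.measurable_filtration_pair hk hkn))

theorem measurable_filtration_Y (h : IsInput P p X₁ A β Y) {k n : ℕ} (hk : 1 ≤ k)
    (hkn : k ≤ n) : Measurable[h.filtration n] (Y k) :=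
  measurable_snd.comp (h.measurable_filtration_pair hk hkn)

theorem measureReal_memory_eq (h : IsInput P p X₁ A β Y) {n k : ℕ} (hn : 1 ≤ n)
    (hk : k ∈ Finset.Icc 1 n) : P.real {ω | β n ω = k} = (n : ℝ)⁻¹ := by
  have h1 : P {ω | β n ω = k} = uniformOn (Set.Icc 1 n) {k} := by
    rw [← h.law_memory n hn, Measure.map_apply (h.measurable_memory n hn)
      (measurableSet_singleton k)]
    rfl
  rw [measureReal_def, h1]
  have h2 := uniformOn_apply_finset (s := Finset.Icc 1 n) (t := {k})
  rw [Finset.coe_Icc, Finset.coe_singleton, Finset.inter_singleton_of_mem hk] at h2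
  simp [h2]

theorem measurable_indicator_memory (h : IsInput P p X₁ A β Y) {n : ℕ} (hn : 1 ≤ n) (k : ℕ) :
    Measurable fun ω => if β n ω = k then (1 : ℝ) else 0 :=
  Measurable.ite (h.measurable_memory n hn (measurableSet_singleton k))
    measurable_const measurable_const

theorem integral_indicator_memory (h : IsInput P p X₁ A β Y) {n k : ℕ} (hn : 1 ≤ n)
    (hk : k ∈ Finset.Icc 1 n) : ∫ ω, (if β n ω = k then (1 : ℝ) else 0) ∂P = (n : ℝ)⁻¹ := by
  have hs : MeasurableSet {ω | β n ω = k} :=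
    h.measurable_memory n hn (measurableSet_singleton k)
  rw [← h.measureReal_memory_eq hn hk, ← integral_indicator_one hs]
  exact integral_congr_ae (ae_of_all _ fun ω => by simp [Set.indicator_apply])

theorem integral_entry (h : IsInput P p X₁ A β Y) (hd : 1 ≤ d) (hp₀ : 0 ≤ p) (hp₁ : p ≤ 1)
    {n : ℕ} (hn : 2 ≤ n) (i j : Fin d) :
    ∫ ω, A n ω i j ∂P = meanCoeff d p * (1 : Matrix (Fin d) (Fin d) ℝ) i j := by
  rw [← integral_entry_matrixLaw hd hp₀ hp₁, ← h.law_matrix n hn,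
    integral_map (h.measurable_matrix n hn).aemeasurable
      (measurable_entry i j).aestronglyMeasurable]

theorem integrable_entry [IsProbabilityMeasure P] (h : IsInput P p X₁ A β Y)
    {n : ℕ} (hn : 2 ≤ n) (i j : Fin d) : Integrable (fun ω => A n ω i j) P := by
  have h2 : ∀ᵐ ω ∂P, ∀ v, ‖A n ω *ᵥ v‖ ≤ ‖v‖ :=
    ae_of_ae_map (h.measurable_matrix _ (by omega)).aemeasurable
      (h.law_matrix n hn ▸ ae_matrixLaw_norm_mulVec_le d p)
  refine Integrable.of_bound
    ((measurable_entry i j).comp (h.measurable_matrix n hn)).aestronglyMeasurable 1 ?_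
  filter_upwards [h2] with ω hω
  -- The entry `A i j` is coordinate `i` of `A e_j`.
  have := (norm_le_pi_norm (A n ω *ᵥ Pi.single j 1) i).trans (hω (Pi.single j 1))
  simpa [Pi.norm_single] using this

/-! ### One-step prediction from the history -/

variable [IsProbabilityMeasure P]

/-- The integral of a history-measurable function against the innovation of the next step. -/
theorem integral_mul_X_succ (h : IsInput P p X₁ A β Y) (hd : 1 ≤ d) (hp₀ : 0 ≤ p) (hp₁ : p ≤ 1)
    {n : ℕ} (hn : 1 ≤ n) (i : Fin d) {φ : ℝ → ℝ} (hφ : Measurable φ)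
    (hφi : Integrable (fun ω => φ (Y (n + 1) ω)) P) {G : Ω → ℝ}
    (hG : Measurable[h.filtration n] G) (hGi : Integrable G P) :
    ∫ ω, G ω * (φ (Y (n + 1) ω) * X X₁ A β (n + 1) ω i) ∂P =
      meanCoeff d p / n * (∫ ω, φ (Y (n + 1) ω) ∂P) *
        ∫ ω, G ω * ∑ k ∈ Finset.Icc 1 n, X X₁ A β k ω i ∂P := by
  have hX : ∀ k j, Integrable (fun ω => G ω * X X₁ A β k ω j) P := fun k j => by
    refine hGi.mul_bdd (c := 1) ((measurable_pi_apply j).comp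
      (h.measurable_X k)).aestronglyMeasurable ?_
    filter_upwards [h.ae_norm_X_le] with ω hω
    exact (norm_le_pi_norm _ j).trans (hω k)
  -- Doob–Dynkin: `G` is a function of the history tuple, the object appearing in `indep_history`.
  obtain ⟨g, hg, rfl⟩ := hG.exists_eq_measurable_comp
  have hBi : ∀ k, Integrable (fun ω => if β n ω = k then (1 : ℝ) else 0) P := fun k =>
    Integrable.of_bound (h.measurable_indicator_memory hn k).aestronglyMeasurable 1
      (ae_of_all _ fun ω => by split_ifs <;> simp)
  have hBφm : ∀ k, Measurable fun q : ℕ × ℝ => (if q.1 = k then (1 : ℝ) else 0) * φ q.2 :=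
    fun k => ((measurable_of_countable fun q : ℕ => if q = k then (1 : ℝ) else 0).comp
      measurable_fst).mul (hφ.comp measurable_snd)
  -- The expectation factors by nested independence: `β` from `Y`, then `A` from `(β, Y)`, then the
  -- triple from the history.
  have hBφ : ∀ k, IndepFun (fun ω => if β n ω = k then (1 : ℝ) else 0)
      (fun ω => φ (Y (n + 1) ω)) P := fun k =>
    (h.indep_memory_size n hn).comp (φ := fun q => if q = k then (1 : ℝ) else 0)
      (measurable_of_countable _) hφ
  have hABφ : ∀ j k, IndepFun (fun ω => A (n + 1) ω i j)
      (fun ω => (if β n ω = k then (1 : ℝ) else 0) * φ (Y (n + 1) ω)) P := fun j k =>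
    (h.indep_matrix n hn).comp (measurable_entry i j) (hBφm k)
  have hall : ∀ j, ∀ k (_ : k ∈ Finset.Icc 1 n), IndepFun
      (fun ω => A (n + 1) ω i j * ((if β n ω = k then (1 : ℝ) else 0) * φ (Y (n + 1) ω)))
      (fun ω => (g ∘ history X₁ A β Y n) ω * X X₁ A β k ω j) P := fun j k hk => by
    have h1 : Measurable fun q : Matrix (Fin d) (Fin d) ℝ × ℕ × ℝ =>
        q.1 i j * ((if q.2.1 = k then (1 : ℝ) else 0) * φ q.2.2) :=
      ((measurable_entry i j).comp measurable_fst).mul ((hBφm k).comp measurable_snd)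
    have h2 : Measurable fun q : Finset.Icc 1 n → (Fin d → ℝ) × ℝ =>
        g q * (q ⟨k, hk⟩).1 j :=
      hg.mul ((measurable_pi_apply j).comp (measurable_fst.comp (measurable_pi_apply _)))
    exact (h.indep_history n hn).comp h1 h2
  have hBφi : ∀ k, Integrable
      (fun ω => (if β n ω = k then (1 : ℝ) else 0) * φ (Y (n + 1) ω)) P :=
    fun k => (hBφ k).integrable_mul (hBi k) hφi
  have hAi : ∀ j, Integrable (fun ω => A (n + 1) ω i j) P :=
    fun j => h.integrable_entry (by omega) i j
  have hABφi : ∀ j k, Integrable (fun ω => A (n + 1) ω i j *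
      ((if β n ω = k then (1 : ℝ) else 0) * φ (Y (n + 1) ω))) P :=
    fun j k => (hABφ j k).integrable_mul (hAi j) (hBφi k)
  have hterm : ∀ j, ∀ k ∈ Finset.Icc 1 n,
      ∫ ω, A (n + 1) ω i j * ((if β n ω = k then (1 : ℝ) else 0) * φ (Y (n + 1) ω)) *
        ((g ∘ history X₁ A β Y n) ω * X X₁ A β k ω j) ∂P =
      meanCoeff d p * (1 : Matrix (Fin d) (Fin d) ℝ) i j *
        ((n : ℝ)⁻¹ * ∫ ω, φ (Y (n + 1) ω) ∂P) *
          ∫ ω, (g ∘ history X₁ A β Y n) ω * X X₁ A β k ω j ∂P := fun j k hk => by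
    rw [(hall j k hk).integral_fun_mul_eq_mul_integral (hABφi j k).1 (hX k j).1,
      (hABφ j k).integral_fun_mul_eq_mul_integral (hAi j).1 (hBφi k).1,
      (hBφ k).integral_fun_mul_eq_mul_integral (hBi k).1 hφi.1,
      h.integral_entry hd hp₀ hp₁ (by omega), h.integral_indicator_memory hn hk]
  calc ∫ ω, (g ∘ history X₁ A β Y n) ω * (φ (Y (n + 1) ω) * X X₁ A β (n + 1) ω i) ∂P
      = ∫ ω, ∑ k ∈ Finset.Icc 1 n, ∑ j,
          A (n + 1) ω i j * ((if β n ω = k then (1 : ℝ) else 0) * φ (Y (n + 1) ω)) *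
            ((g ∘ history X₁ A β Y n) ω * X X₁ A β k ω j) ∂P := by
        congr 1 with ω
        rw [X_succ_apply hn]
        simp_rw [Finset.mul_sum]
        refine Finset.sum_congr rfl fun k _ => Finset.sum_congr rfl fun j _ => ?_
        ring
    _ = ∑ k ∈ Finset.Icc 1 n, ∑ j, meanCoeff d p * (1 : Matrix (Fin d) (Fin d) ℝ) i j *
        ((n : ℝ)⁻¹ * ∫ ω, φ (Y (n + 1) ω) ∂P) *
          ∫ ω, (g ∘ history X₁ A β Y n) ω * X X₁ A β k ω j ∂P := by
        have hi : ∀ k ∈ Finset.Icc 1 n, ∀ j, Integrable (fun ω => A (n + 1) ω i j *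
            ((if β n ω = k then (1 : ℝ) else 0) * φ (Y (n + 1) ω)) *
            ((g ∘ history X₁ A β Y n) ω * X X₁ A β k ω j)) P :=
          fun k hk j => (hall j k hk).integrable_mul (hABφi j k) (hX k j)
        rw [integral_finsetSum _ fun k hk => integrable_finsetSum _ fun j _ => hi k hk j]
        refine Finset.sum_congr rfl fun k hk => ?_
        rw [integral_finsetSum _ fun j _ => hi k hk j]
        exact Finset.sum_congr rfl fun j _ => hterm j k hk
    _ = _ := by
        simp_rw [Finset.mul_sum]
        rw [integral_finsetSum _ fun k _ => hX k i, Finset.mul_sum]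
        refine Finset.sum_congr rfl fun k _ => ?_
        -- The mean matrix is scalar, so only `j = i` survives and the coordinates decouple.
        rw [Finset.sum_eq_single i (fun j _ hj => by simp [Matrix.one_apply_ne hj.symm])
          (by simp), Matrix.one_apply_eq]
        ring

end IsInput
end MERW

/-! ### Square-integrable martingales -/

/-- A martingale which is bounded in `L²` converges almost everywhere. -/
theorem ae_exists_tendsto_of_integral_sq_le {Ω : Type*} [m : MeasurableSpace Ω] {μ : Measure Ω}
    [IsProbabilityMeasure μ] {ℱ : Filtration ℕ m} {f : ℕ → Ω → ℝ} {R : ℝ}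
    (hf : Martingale f ℱ μ) (hf2 : ∀ n, MemLp (f n) 2 μ) (hR : ∀ n, ∫ ω, f n ω ^ 2 ∂μ ≤ R) :
    ∀ᵐ ω ∂μ, ∃ c, Tendsto (fun n => f n ω) atTop (𝓝 c) := by
  refine hf.submartingale.exists_ae_tendsto_of_bdd (R := (1 + R).toNNReal) fun n => ?_
  rw [eLpNorm_one_eq_lintegral_enorm, ← ofReal_integral_norm_eq_lintegral_enorm (hf.integrable n)]
  refine ENNReal.ofReal_le_ofReal ?_
  calc ∫ ω, ‖f n ω‖ ∂μ ≤ ∫ ω, (1 + f n ω ^ 2) ∂μ := by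
        refine integral_mono (hf.integrable n).norm
          ((integrable_const _).add (hf2 n).integrable_sq) fun ω => ?_
        change |f n ω| ≤ 1 + f n ω ^ 2
        nlinarith [sq_abs (f n ω), sq_nonneg (|f n ω| - 1), abs_nonneg (f n ω)]
    _ ≤ 1 + R := by
        rw [integral_add (integrable_const _) (hf2 n).integrable_sq]
        simpa using hR n

/-- Serves both second-moment recursions: for `dirSum` the cross term is the drift, for the
martingale of centred steps it vanishes. -/
theorem integral_add_const_mul_sq {Ω : Type*} [MeasurableSpace Ω] {μ : Measure Ω} {f g : Ω → ℝ}
    (hf : MemLp f 2 μ) (hg : MemLp g 2 μ) (c : ℝ) :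
    ∫ ω, (f ω + c * g ω) ^ 2 ∂μ =
      ∫ ω, f ω ^ 2 ∂μ + 2 * c * (∫ ω, f ω * g ω ∂μ) + c ^ 2 * ∫ ω, g ω ^ 2 ∂μ := by
  have hfg : Integrable (fun ω => 2 * c * (f ω * g ω)) μ := (hf.integrable_mul hg).const_mul _
  have h1 : Integrable (fun ω => f ω ^ 2 + 2 * c * (f ω * g ω)) μ := hf.integrable_sq.add hfg
  rw [← integral_const_mul, ← integral_const_mul, ← integral_add hf.integrable_sq hfg,
    ← integral_add h1 (hg.integrable_sq.const_mul _)]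
  congr 1 with ω
  ring

/-! ### Second moments and centred steps -/

namespace MERW

variable {Ω : Type*} {d : ℕ} {X₁ : Ω → Fin d → ℝ}
  {A : ℕ → Ω → Matrix (Fin d) (Fin d) ℝ} {β : ℕ → Ω → ℕ} {Y : ℕ → Ω → ℝ}

/-- The `i`-th coordinate of `X_1 + ⋯ + X_n`. -/
def dirSum (X₁ : Ω → Fin d → ℝ) (A : ℕ → Ω → Matrix (Fin d) (Fin d) ℝ) (β : ℕ → Ω → ℕ)
    (i : Fin d) (n : ℕ) (ω : Ω) : ℝ :=
  ∑ k ∈ Finset.Icc 1 n, X X₁ A β k ω i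

theorem dirSum_succ (i : Fin d) (n : ℕ) (ω : Ω) :
    dirSum X₁ A β i (n + 1) ω = dirSum X₁ A β i n ω + X X₁ A β (n + 1) ω i := by
  simp [dirSum, Finset.sum_Icc_succ_top]

namespace IsInput

variable [MeasurableSpace Ω] {P : Measure Ω} {p : ℝ}

theorem measurable_filtration_dirSum (h : IsInput P p X₁ A β Y) (i : Fin d) (n : ℕ) :
    Measurable[h.filtration n] (dirSum X₁ A β i n) := by
  refine Finset.measurable_fun_sum (m := h.filtration n) _ fun k hk => ?_
  have hk' := Finset.mem_Icc.1 hk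
  exact h.measurable_filtration_X hk'.1 hk'.2 i

theorem ae_abs_X_le (h : IsInput P p X₁ A β Y) (i : Fin d) :
    ∀ᵐ ω ∂P, ∀ n, |X X₁ A β n ω i| ≤ 1 := by
  filter_upwards [h.ae_norm_X_le] with ω hω n
  exact (norm_le_pi_norm _ i).trans (hω n)

theorem ae_abs_dirSum_le (h : IsInput P p X₁ A β Y) (i : Fin d) :
    ∀ᵐ ω ∂P, ∀ n, |dirSum X₁ A β i n ω| ≤ n := by
  filter_upwards [h.ae_abs_X_le i] with ω hω n
  refine (Finset.abs_sum_le_sum_abs _ _).trans ((Finset.sum_le_sum fun k _ => hω k).trans ?_)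
  simp

/-- The centred step `T_{n+2} - E[T_{n+2} | history]` in coordinate `i`. -/
noncomputable def centredStep (_ : IsInput P p X₁ A β Y) (i : Fin d) (n : ℕ) (ω : Ω) : ℝ :=
  Y (n + 2) ω * X X₁ A β (n + 2) ω i -
    meanCoeff d p / (n + 1 : ℕ) * (∫ ω, Y 2 ω ∂P) * dirSum X₁ A β i (n + 1) ω

theorem measurable_filtration_centredStep (h : IsInput P p X₁ A β Y) (i : Fin d) (n : ℕ) :
    Measurable[h.filtration (n + 2)] (h.centredStep i n) := by
  have h1 := h.measurable_filtration_Y (k := n + 2) (n := n + 2) (by omega) le_rfl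
  have h2 := h.measurable_filtration_X (k := n + 2) (n := n + 2) (by omega) le_rfl i
  have h3 := (h.measurable_filtration_dirSum i (n + 1)).mono
    (h.filtration.mono (Nat.le_succ (n + 1))) le_rfl
  exact Measurable.sub (m := h.filtration (n + 2)) (h1.mul h2) (h3.const_mul _)

theorem memLp_stepSize_mul_X (h : IsInput P p X₁ A β Y) (i : Fin d) (n : ℕ) :
    MemLp (fun ω => Y (n + 2) ω * X X₁ A β (n + 2) ω i) 2 P := by
  refine MemLp.mono (h.size_memLp (n + 2) (by omega))
    ((h.measurable_size _ (by omega)).mul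
      ((measurable_pi_apply i).comp (h.measurable_X _))).aestronglyMeasurable ?_
  filter_upwards [h.ae_abs_X_le i] with ω hω
  rw [norm_mul]
  exact mul_le_of_le_one_right (norm_nonneg _) (hω _)

variable [IsProbabilityMeasure P]

theorem memLp_X (h : IsInput P p X₁ A β Y) (i : Fin d) (n : ℕ) (q : ENNReal) :
    MemLp (fun ω => X X₁ A β n ω i) q P :=
  MemLp.of_bound ((measurable_pi_apply i).comp (h.measurable_X n)).aestronglyMeasurable 1
    ((h.ae_abs_X_le i).mono fun _ hω => hω n)

theorem memLp_dirSum (h : IsInput P p X₁ A β Y) (i : Fin d) (n : ℕ) (q : ENNReal) :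
    MemLp (dirSum X₁ A β i n) q P :=
  memLp_finsetSum _ fun k _ => h.memLp_X i k q

/-- In the diffusive regime the second moment of `X_1 + ⋯ + X_n` grows at most linearly. -/
theorem exists_integral_sq_dirSum_le (h : IsInput P p X₁ A β Y) (hd : 1 ≤ d) (hp₀ : 0 ≤ p)
    (hp₁ : p < (2 * d + 1) / (4 * d)) (i : Fin d) :
    ∃ C : ℝ, ∀ n, 1 ≤ n → ∫ ω, dirSum X₁ A β i n ω ^ 2 ∂P ≤ C * n := by
  -- For small `p` the mean coefficient is negative; its positive part lets the induction hypothesis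
  -- be multiplied through.
  set b : ℝ := max (meanCoeff d p) 0 with hb
  have hb2 : 0 < 1 - 2 * b := by
    have : b < 1 / 2 := max_lt (meanCoeff_lt_half hd hp₁) (by norm_num)
    linarith
  have hX2 : ∀ n, ∫ ω, X X₁ A β n ω i ^ 2 ∂P ≤ 1 := fun n => by
    calc ∫ ω, X X₁ A β n ω i ^ 2 ∂P ≤ ∫ _, (1 : ℝ) ∂P := by
          refine integral_mono_ae (h.memLp_X i n 2).integrable_sq (integrable_const _) ?_
          filter_upwards [h.ae_abs_X_le i] with ω hω
          exact (sq_le_one_iff_abs_le_one _).2 (hω n)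
      _ = 1 := by simp
  -- The constant solves `C = 2 b C + 1`, which closes the recursion.
  refine ⟨1 / (1 - 2 * b), fun n hn => ?_⟩
  induction n, hn using Nat.le_induction with
  | base =>
    have : 1 ≤ 1 / (1 - 2 * b) := by
      rw [le_div_iff₀ hb2]
      linarith [le_max_right (meanCoeff d p) 0]
    simpa [dirSum] using (hX2 1).trans this
  | succ n hn ih =>
    -- Taking `φ = 1` drops the step size and leaves the cross moment `(a / n) E[W_n²]`.
    have hn0 : (0 : ℝ) < n := by exact_mod_cast hn
    have hcross := h.integral_mul_X_succ hd hp₀ (le_one_of_lt_critical hd hp₁) hn i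
      (φ := fun _ => 1) measurable_const (integrable_const _)
      (h.measurable_filtration_dirSum i n) ((h.memLp_dirSum i n 1).integrable le_rfl)
    change _ = _ * ∫ ω, dirSum X₁ A β i n ω * dirSum X₁ A β i n ω ∂P at hcross
    simp only [one_mul, integral_const, probReal_univ, smul_eq_mul, ← pow_two]
      at hcross
    have hexp : ∫ ω, dirSum X₁ A β i (n + 1) ω ^ 2 ∂P =
        ∫ ω, dirSum X₁ A β i n ω ^ 2 ∂P +
          2 * (∫ ω, dirSum X₁ A β i n ω * X X₁ A β (n + 1) ω i ∂P) +
          ∫ ω, X X₁ A β (n + 1) ω i ^ 2 ∂P := by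
      simpa [dirSum_succ] using
        integral_add_const_mul_sq (h.memLp_dirSum i n 2) (h.memLp_X i (n + 1) 2) 1
    have h0 : 0 ≤ ∫ ω, dirSum X₁ A β i n ω ^ 2 ∂P := integral_nonneg fun ω => sq_nonneg _
    have hle : meanCoeff d p / n * ∫ ω, dirSum X₁ A β i n ω ^ 2 ∂P ≤ b / (1 - 2 * b) := by
      calc meanCoeff d p / n * ∫ ω, dirSum X₁ A β i n ω ^ 2 ∂P
          ≤ b / n * (1 / (1 - 2 * b) * n) := by
            refine mul_le_mul ?_ ih h0 (div_nonneg (le_max_right _ _) hn0.le)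
            exact div_le_div_of_nonneg_right (le_max_left _ _) hn0.le
        _ = b / (1 - 2 * b) := by field_simp
    rw [hexp, hcross]
    have := hX2 (n + 1)
    have key : 1 / (1 - 2 * b) = 2 * (b / (1 - 2 * b)) + 1 := by field_simp; ring
    push_cast
    rw [mul_add, mul_one]
    linarith

theorem memLp_centredStep (h : IsInput P p X₁ A β Y) (i : Fin d) (n : ℕ) :
    MemLp (h.centredStep i n) 2 P :=
  (h.memLp_stepSize_mul_X i n).sub ((h.memLp_dirSum i (n + 1) 2).const_mul _)

/-- Taking `G` an indicator gives the martingale property; taking `G` the martingale itself gives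
orthogonality of increments. -/
theorem integral_mul_centredStep (h : IsInput P p X₁ A β Y) (hd : 1 ≤ d) (hp₀ : 0 ≤ p)
    (hp₁ : p ≤ 1) (i : Fin d) (n : ℕ) {G : Ω → ℝ} (hG : Measurable[h.filtration (n + 1)] G)
    (hG2 : MemLp G 2 P) : ∫ ω, G ω * h.centredStep i n ω ∂P = 0 := by
  have h1 := h.integral_mul_X_succ hd hp₀ hp₁ (n := n + 1) (by omega) i (φ := fun y => y)
    measurable_id ((h.size_memLp (n + 2) (by omega)).integrable (by norm_num)) hG
    (hG2.integrable (by norm_num))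
  change ∫ ω, G ω * (Y (n + 2) ω * X X₁ A β (n + 2) ω i) ∂P = _ * (∫ ω, Y (n + 2) ω ∂P) *
    ∫ ω, G ω * dirSum X₁ A β i (n + 1) ω ∂P at h1
  rw [(h.size_identDistrib (n + 2) (by omega)).integral_eq] at h1
  have hi1 : Integrable (fun ω => G ω * (Y (n + 2) ω * X X₁ A β (n + 2) ω i)) P :=
    hG2.integrable_mul (h.memLp_stepSize_mul_X i n)
  have hi2 : Integrable (fun ω => G ω * dirSum X₁ A β i (n + 1) ω) P :=
    hG2.integrable_mul (h.memLp_dirSum i (n + 1) 2)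
  calc ∫ ω, G ω * h.centredStep i n ω ∂P
      = ∫ ω, (G ω * (Y (n + 2) ω * X X₁ A β (n + 2) ω i) -
          meanCoeff d p / (n + 1 : ℕ) * (∫ ω, Y 2 ω ∂P) *
            (G ω * dirSum X₁ A β i (n + 1) ω)) ∂P := by
        congr 1 with ω
        rw [centredStep]
        ring
    _ = 0 := by
        rw [integral_sub hi1 (hi2.const_mul _), integral_const_mul, h1, sub_self]

/-- Uses `(u - v)² ≤ 2 u² + 2 v²` with `|X| ≤ 1` and `|W_n| ≤ n`; the `Y (n + 2)` share one second
moment. -/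
theorem exists_integral_sq_centredStep_le (h : IsInput P p X₁ A β Y) (i : Fin d) :
    ∃ K : ℝ, 0 ≤ K ∧ ∀ n, ∫ ω, h.centredStep i n ω ^ 2 ∂P ≤ K := by
  set c : ℝ := meanCoeff d p * ∫ ω, Y 2 ω ∂P with hc
  have hY : ∀ n, ∫ ω, Y (n + 2) ω ^ 2 ∂P = ∫ ω, Y 2 ω ^ 2 ∂P := fun n =>
    ((h.size_identDistrib (n + 2) (by omega)).comp
      (u := fun y : ℝ => y ^ 2) (measurable_id.pow_const 2)).integral_eq
  have h0 : 0 ≤ ∫ ω, Y 2 ω ^ 2 ∂P := integral_nonneg fun ω => sq_nonneg _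
  refine ⟨2 * (∫ ω, Y 2 ω ^ 2 ∂P) + 2 * c ^ 2, by positivity, fun n => ?_⟩
  have hYi := (h.size_memLp (n + 2) (by omega)).integrable_sq
  calc ∫ ω, h.centredStep i n ω ^ 2 ∂P ≤ ∫ ω, (2 * Y (n + 2) ω ^ 2 + 2 * c ^ 2) ∂P := by
        refine integral_mono_ae (h.memLp_centredStep i n).integrable_sq
          ((hYi.const_mul 2).add (integrable_const _)) ?_
        filter_upwards [h.ae_abs_X_le i, h.ae_abs_dirSum_le i] with ω hX hW
        have hn : (0 : ℝ) < (n + 1 : ℕ) := by positivity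
        have hx : X X₁ A β (n + 2) ω i ^ 2 ≤ 1 := (sq_le_one_iff_abs_le_one _).2 (hX _)
        have hw : (dirSum X₁ A β i (n + 1) ω / (n + 1 : ℕ)) ^ 2 ≤ 1 := by
          rw [sq_le_one_iff_abs_le_one, abs_div, abs_of_pos hn, div_le_one hn]
          exact hW _
        have heq : h.centredStep i n ω = Y (n + 2) ω * X X₁ A β (n + 2) ω i -
            c * (dirSum X₁ A β i (n + 1) ω / (n + 1 : ℕ)) := by
          rw [centredStep, hc]
          ring
        rw [heq]
        calc _ ≤ 2 * (Y (n + 2) ω ^ 2 * X X₁ A β (n + 2) ω i ^ 2) +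
              2 * (c ^ 2 * (dirSum X₁ A β i (n + 1) ω / (n + 1 : ℕ)) ^ 2) := by
              nlinarith [sq_nonneg (Y (n + 2) ω * X X₁ A β (n + 2) ω i +
                c * (dirSum X₁ A β i (n + 1) ω / (n + 1 : ℕ)))]
          _ ≤ 2 * Y (n + 2) ω ^ 2 + 2 * c ^ 2 := by
              have := mul_le_of_le_one_right (sq_nonneg (Y (n + 2) ω)) hx
              have := mul_le_of_le_one_right (sq_nonneg c) hw
              linarith
    _ = _ := by
        rw [integral_add (hYi.const_mul 2) (integrable_const _), integral_const_mul, hY]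
        simp

/-! ### Almost sure convergence -/

/-- Square-summable weights make the series of centred steps converge. -/
theorem ae_tendsto_sum_centredStep (h : IsInput P p X₁ A β Y) (hd : 1 ≤ d) (hp₀ : 0 ≤ p)
    (hp₁ : p ≤ 1) (i : Fin d) {c : ℕ → ℝ} (hc : Summable fun n => c n ^ 2) :
    ∀ᵐ ω ∂P, ∃ l, Tendsto (fun n => ∑ k ∈ Finset.range n, c k * h.centredStep i k ω)
      atTop (𝓝 l) := by
  obtain ⟨K, hK0, hK⟩ := h.exists_integral_sq_centredStep_le i
  set M : ℕ → Ω → ℝ := fun n ω => ∑ k ∈ Finset.range n, c k * h.centredStep i k ω with hM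
  -- `M n` ends with the centred step of `T_{n+1}`, so it is adapted to the history shifted by one.
  let ℱ : Filtration ℕ ‹MeasurableSpace Ω› :=
    { seq := fun n => h.filtration (n + 1)
      mono' := fun m n hmn => h.filtration.mono (Nat.succ_le_succ hmn)
      le' := fun n => h.filtration.le (n + 1) }
  have hMm : ∀ n, Measurable[h.filtration (n + 1)] (M n) := fun n => by
    refine Finset.measurable_fun_sum (m := h.filtration (n + 1)) _ fun k hk => ?_
    have hk' := Finset.mem_range.1 hk
    exact ((h.measurable_filtration_centredStep i k).mono
      (h.filtration.mono (by omega)) le_rfl).const_mul _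
  have hM2 : ∀ n, MemLp (M n) 2 P := fun n =>
    memLp_finsetSum _ fun k _ => (h.memLp_centredStep i k).const_mul _
  have hsucc : ∀ n ω, M (n + 1) ω = M n ω + c n * h.centredStep i n ω := fun n ω =>
    Finset.sum_range_succ _ _
  have hmart : Martingale M ℱ P := by
    refine martingale_of_setIntegral_eq_succ (fun n => (hMm n).stronglyMeasurable)
      (fun n => (hM2 n).integrable (by norm_num)) fun n s hs => ?_
    have hs' : MeasurableSet s := ℱ.le n s hs
    have hD := ((h.memLp_centredStep i n).integrable (by norm_num)).const_mul (c n)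
    simp_rw [hsucc]
    rw [integral_add ((hM2 n).integrable (by norm_num)).integrableOn hD.integrableOn]
    have hzero := h.integral_mul_centredStep hd hp₀ hp₁ i n (G := s.indicator fun _ => 1)
      (Measurable.indicator (m := h.filtration (n + 1)) (@measurable_const _ _ _ (_) _) hs)
      (memLp_indicator_const 2 hs' (1 : ℝ) (Or.inr (measure_ne_top _ _)))
    have : ∫ ω in s, c n * h.centredStep i n ω ∂P = 0 := by
      rw [integral_const_mul, ← integral_indicator hs']
      have : s.indicator (h.centredStep i n) =
          fun ω => s.indicator (fun _ => 1) ω * h.centredStep i n ω := by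
        ext ω
        by_cases hω : ω ∈ s <;> simp [hω]
      change c n * ∫ ω, s.indicator (h.centredStep i n) ω ∂P = 0
      rw [this, hzero, mul_zero]
    rw [this, add_zero]
  have hbound : ∀ n, ∫ ω, M n ω ^ 2 ∂P ≤ ∑ k ∈ Finset.range n, c k ^ 2 * K := fun n => by
    induction n with
    | zero => simp [hM]
    | succ n ih =>
      have hexp : ∫ ω, M (n + 1) ω ^ 2 ∂P = ∫ ω, M n ω ^ 2 ∂P +
          2 * c n * (∫ ω, M n ω * h.centredStep i n ω ∂P) +
          c n ^ 2 * ∫ ω, h.centredStep i n ω ^ 2 ∂P := by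
        simp_rw [hsucc]
        exact integral_add_const_mul_sq (hM2 n) (h.memLp_centredStep i n) (c n)
      rw [hexp, h.integral_mul_centredStep hd hp₀ hp₁ i n (hMm n) (hM2 n),
        Finset.sum_range_succ, mul_zero, add_zero]
      exact add_le_add ih (mul_le_mul_of_nonneg_left (hK n) (sq_nonneg _))
  refine ae_exists_tendsto_of_integral_sq_le hmart hM2 (R := ∑' k, c k ^ 2 * K)
    fun n => (hbound n).trans ?_
  exact (hc.mul_right K).sum_le_tsum _ fun k _ => mul_nonneg (sq_nonneg _) hK0

theorem ae_summable_dirSum (h : IsInput P p X₁ A β Y) (hd : 1 ≤ d) (hp₀ : 0 ≤ p)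
    (hp₁ : p < (2 * d + 1) / (4 * d)) (i : Fin d) {α : ℝ} (hα : 1 / 2 < α) :
    ∀ᵐ ω ∂P, Summable fun n : ℕ =>
      (((n + 1 : ℕ) : ℝ) ^ α)⁻¹ * (((n + 1 : ℕ) : ℝ)⁻¹ * dirSum X₁ A β i (n + 1) ω) := by
  obtain ⟨C, hC⟩ := h.exists_integral_sq_dirSum_le hd hp₀ hp₁ i
  have hs : Summable fun n : ℕ => ((n + 1 : ℕ) : ℝ) ^ (-(α + 1 / 2)) :=
    (summable_nat_add_iff 1).2 (Real.summable_nat_rpow.2 (by linarith))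
  -- As `E[W_n²] = O(n)`, the exponent `α + 3 / 2` makes the expectations `O(n ^ (-(α + 1/2)))`,
  -- which is summable.
  have hsq : ∀ᵐ ω ∂P, Summable fun n : ℕ =>
      ((n + 1 : ℕ) : ℝ) ^ (-(α + 3 / 2)) * dirSum X₁ A β i (n + 1) ω ^ 2 := by
    refine ae_summable_of_summable_integral
      (fun n => (h.memLp_dirSum i (n + 1) 2).integrable_sq.const_mul _)
      (fun n ω => by positivity) ?_
    refine Summable.of_nonneg_of_le (fun n => integral_nonneg fun ω => by positivity)
      (fun n => ?_) (hs.mul_left C)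
    have hn : (0 : ℝ) < (n + 1 : ℕ) := by positivity
    rw [integral_const_mul]
    calc _ ≤ ((n + 1 : ℕ) : ℝ) ^ (-(α + 3 / 2)) * (C * (n + 1 : ℕ)) := by
          gcongr
          exact hC (n + 1) (by omega)
      _ = C * (((n + 1 : ℕ) : ℝ) ^ (-(α + 3 / 2)) * ((n + 1 : ℕ) : ℝ) ^ (1 : ℝ)) := by
          rw [Real.rpow_one]
          ring
      _ = C * ((n + 1 : ℕ) : ℝ) ^ (-(α + 1 / 2)) := by
          rw [← Real.rpow_add hn]
          ring_nf
  filter_upwards [hsq] with ω hω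
  refine Summable.of_norm_bounded (hω.add hs) fun n => ?_
  have hn : (0 : ℝ) < (n + 1 : ℕ) := by positivity
  set x : ℝ := ((n + 1 : ℕ) : ℝ)
  set w := dirSum X₁ A β i (n + 1) ω
  set r := x ^ (1 / 2 : ℝ)
  have hr : 0 < r := Real.rpow_pos_of_pos hn _
  have hu : 0 < x ^ (-(α + 3 / 2)) := Real.rpow_pos_of_pos hn _
  have e1 : (x ^ α)⁻¹ * x⁻¹ = x ^ (-(α + 3 / 2)) * r := by
    rw [← Real.rpow_neg hn.le, ← Real.rpow_neg_one, ← Real.rpow_add hn, ← Real.rpow_add hn]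
    ring_nf
  have e2 : x ^ (-(α + 1 / 2)) = x ^ (-(α + 3 / 2)) * r ^ 2 := by
    rw [pow_two, ← mul_assoc, ← Real.rpow_add hn, ← Real.rpow_add hn]
    ring_nf
  rw [← mul_assoc, e1, e2, Real.norm_eq_abs, abs_mul, abs_of_pos (mul_pos hu hr), mul_assoc,
    ← mul_add]
  refine mul_le_mul_of_nonneg_left ?_ hu.le
  -- This is `|w| √x ≤ w² + x`, from `(|w| - √x)² ≥ 0`.
  nlinarith [sq_abs w, sq_nonneg (|w| - r), abs_nonneg w]

theorem ae_tendsto_S_apply (h : IsInput P p X₁ A β Y) (hd : 1 ≤ d) (hp₀ : 0 ≤ p)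
    (hp₁ : p < (2 * d + 1) / (4 * d)) (i : Fin d) {α : ℝ} (hα : 1 / 2 < α) :
    ∀ᵐ ω ∂P, Tendsto (fun n : ℕ => ((n : ℝ) ^ α)⁻¹ * S X₁ A β Y n ω i) atTop (𝓝 0) := by
  -- With `b n = (n + 1) ^ α`, Kronecker's normalisation at `n` is that of `S_{n+1}`, whose terms
  -- are `T_1` and `T_{k+2}` for `k < n`.
  set b : ℕ → ℝ := fun n => ((n + 1 : ℕ) : ℝ) ^ α with hb
  have hb0 : ∀ n, 0 < b n := fun n => Real.rpow_pos_of_pos (by positivity) _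
  have hbm : Monotone b := fun m n hmn =>
    Real.rpow_le_rpow (by positivity) (by exact_mod_cast Nat.succ_le_succ hmn) (by linarith)
  have hbt : Tendsto b atTop atTop := (tendsto_rpow_atTop (by linarith)).comp
    (tendsto_natCast_atTop_atTop.comp (tendsto_add_atTop_nat 1))
  have hc : Summable fun n => (b n)⁻¹ ^ 2 := by
    have : Summable fun n : ℕ => ((n + 1 : ℕ) : ℝ) ^ (-(2 * α)) :=
      (summable_nat_add_iff 1).2 (Real.summable_nat_rpow.2 (by linarith))
    refine this.congr fun n => ?_
    rw [hb, inv_pow, Real.rpow_neg (by positivity), ← Real.rpow_natCast, ← Real.rpow_mul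
      (by positivity)]
    ring_nf
  filter_upwards [h.ae_tendsto_sum_centredStep hd hp₀ (le_one_of_lt_critical hd hp₁) i hc,
    h.ae_summable_dirSum hd hp₀ hp₁ i hα] with ω ⟨l, hl⟩ hsum
  have hsum' := ((hsum.mul_left (meanCoeff d p * ∫ ω, Y 2 ω ∂P)).hasSum.tendsto_sum_nat)
  have hadd := hl.add hsum'
  simp_rw [← Finset.sum_add_distrib] at hadd
  have hstep : ∀ k : ℕ, (b k)⁻¹ * h.centredStep i k ω + meanCoeff d p * (∫ ω, Y 2 ω ∂P) *
      ((((k + 1 : ℕ) : ℝ) ^ α)⁻¹ * (((k + 1 : ℕ) : ℝ)⁻¹ * dirSum X₁ A β i (k + 1) ω)) =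
      (b k)⁻¹ * T X₁ A β Y (k + 2) ω i := fun k => by
    simp only [hb, centredStep, T, Pi.smul_apply, smul_eq_mul]
    ring
  simp_rw [hstep] at hadd
  have hkron := tendsto_inv_mul_sum_of_tendsto_sum hbm hbt hadd
  simp_rw [mul_inv_cancel_left₀ (hb0 _).ne'] at hkron
  -- `T_1` has no preceding history and lies outside the series; divided by `b n` it vanishes.
  have hfirst : Tendsto (fun n => (b n)⁻¹ * T X₁ A β Y 1 ω i) atTop (𝓝 0) := by
    simpa using (tendsto_inv_atTop_zero.comp hbt).mul_const (T X₁ A β Y 1 ω i)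
  rw [← tendsto_add_atTop_iff_nat 1]
  have hlim := hkron.add hfirst
  rw [add_zero] at hlim
  refine hlim.congr fun n => ?_
  have hS : S X₁ A β Y (n + 1) ω i =
      ∑ k ∈ Finset.range n, T X₁ A β Y (k + 2) ω i + T X₁ A β Y 1 ω i := by
    induction n with
    | zero => simp [S]
    | succ n ih =>
      have : S X₁ A β Y (n + 1 + 1) ω i =
          S X₁ A β Y (n + 1) ω i + T X₁ A β Y (n + 2) ω i := by
        simp [S, Finset.sum_Icc_succ_top]
      rw [this, ih, Finset.sum_range_succ]
      ring
  rw [hS, mul_add]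

end IsInput
end MERW

theorem mainTheorem9 {Ω : Type*} [MeasurableSpace Ω] (P : Measure Ω) [IsProbabilityMeasure P]
    (d : ℕ) (hd : 1 ≤ d) (p : ℝ) (hp₀ : 0 ≤ p) (hp₁ : p < (2 * d + 1) / (4 * d))
    (X₁ : Ω → Fin d → ℝ) (A : ℕ → Ω → Matrix (Fin d) (Fin d) ℝ) (β : ℕ → Ω → ℕ) (Y : ℕ → Ω → ℝ)
    (h : MERW.IsInput P p X₁ A β Y) (α : ℝ) (hα : 1 / 2 < α) :
    ∀ᵐ ω ∂P, Tendsto (fun n : ℕ => ((n : ℝ) ^ α)⁻¹ • MERW.S X₁ A β Y n ω) atTop (𝓝 0) := by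
  have hall := ae_all_iff.2 fun i => h.ae_tendsto_S_apply hd hp₀ hp₁ i hα
  filter_upwards [hall] with ω hω
  exact tendsto_pi_nhds.2 fun i => hω i
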